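/- **Setting.** Consider the infinite triangular grid; each node $v$ has six neighbours $N(v)$, in the directions $\mathbb E,\mathbb{NE},\mathbb{NW},\mathbb W,\mathbb{SW},\mathbb{SE}$, known to all particles (common orientation). Each of $n$ particles occupies one node, each node holds at most one particle, and a particle is either *contracted*, or *expanded* along an edge from its node $v$ to a neighbour $u$ ("toward $u$"). A *configuration* consists of the nodes and states of all particles; it is *connected* if the occupied nodes induce a (non-empty) connected subgraph of the grid. The *bounding box* of a configuration is the smallest parallelogram with sides parallel to the West–East and SouthWest–NorthEast directions that contains all particles, and its *floor* is the West–East grid line through the southern side of the bounding box. **Algorithm WRain.** Number the 18 nodes at distance 1 or 2 from $v$ row by row from North to South, from West to East in each row: $1,2,3$; $4,5,6,7$; $8,9,(v),10,11$; $12,13,14,15$; $16,17,18$. Let $\mathrm{Upper}(v)$ (resp. $\mathrm{Lower}(v)$) hold if a node at one of the positions $\{1,2,4,5,6\}$ (resp. $\{13,14,15,17,18\}$) is occupied; let $\mathrm{Pointed}(v)$ hold if some particle on a neighbour of $v$ is expanded toward $v$; let $\mathrm{Near}(v)$ hold if some empty $u\in N(v)$ satisfies $\mathrm{Pointed}(u)$.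 A contracted particle at $v$ decides as follows: if $\mathrm{Near}(v)$, do nothing; otherwise, if $\mathrm{Pointed}(v)$, expand toward $\mathbb E$; otherwise, if $\neg\mathrm{Upper}(v)\wedge\mathrm{Lower}(v)$, expand toward $\mathbb{SE}$; otherwise do nothing. **Executions (SILBOT model, asynchronous).** Initially all particles are inactive. At each time step an adversary activates an arbitrary set of particles. An activated inactive particle senses the current configuration and computes its next action; at its next activation (after an arbitrary delay, hence possibly on outdated information) it executes this action and becomes inactive again. The action of a contracted particle is the one decided by WRain. The action of an expanded particle is to move to the node it is expanded toward, becoming contracted there, if it senses that this node is empty, and to do nothing otherwise. A move to a node that is occupied at the time of execution fails (the particle stays expanded), and an expansion along an edge that is already occupied by an expanded particle fails. If several particles simultaneously execute moves to the same empty node, or expansions along the same free edge, exactly one of them, chosen by the adversary, succeeds. The schedule is fair: each particle is activated infinitely often. **Theorem.** Let $C_0$ be a connected configuration of $n$ contracted particles. In every such execution of WRain from $C_0$, there is a time after which the configuration no longer changes, and in this last configuration all particles are contracted, the configuration is connected, and all particles lie on the floor of $C_0$. -/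

import Mathlib

namespace SILBOT

/-! ### The triangular grid -/

/-- Nodes of the infinite triangular grid: `(a, b)` stands for the point `a • E + b • NE` of the
plane, where `E` and `NE` are unit vectors at an angle of 60 degrees. The first axis is the
West--East direction, the second one the SouthWest--NorthEast direction. -/
abbrev Node : Type := ℤ × ℤ

/-- The six directions of the grid (the particles share this orientation). -/
inductive Dir : Type
  | E | NE | NW | W | SW | SE

/-- The displacement of one hop in a direction. -/
def Dir.vec : Dir → Node
  | .E => (1, 0)
  | .NE => (0, 1)
  | .NW => (-1, 1)
  | .W => (-1, 0)
  | .SW => (0, -1)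
  | .SE => (1, -1)

/-- The triangular grid as a graph: every node has six neighbours. -/
def triGrid : SimpleGraph Node where
  Adj u v := ∃ d : Dir, v = u + d.vec
  symm := ⟨by
    rintro u v ⟨d, rfl⟩
    cases d
    exacts [⟨.W, by simp [Dir.vec, add_assoc]⟩, ⟨.SW, by simp [Dir.vec, add_assoc]⟩,
      ⟨.SE, by simp [Dir.vec, add_assoc]⟩, ⟨.E, by simp [Dir.vec, add_assoc]⟩,
      ⟨.NE, by simp [Dir.vec, add_assoc]⟩, ⟨.NW, by simp [Dir.vec, add_assoc]⟩]⟩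
  loopless := ⟨by
    rintro u ⟨d, h⟩
    cases d <;> simp [Dir.vec] at h⟩

/-! ### Configurations -/

/-- The two states of a particle. An expanded particle occupies its node and the edge leaving that
node in the given direction; it is committed to move along this edge. -/
inductive PState : Type
  | contracted
  | expanded (d : Dir)

/-- A configuration of `n` particles: each particle occupies one node and has a state, and each
node holds at most one particle. -/
structure Config (n : ℕ) where
  pos : Fin n → Node
  state : Fin n → PState
  inj : Function.Injective pos

namespace Config

variable {n : ℕ}

/-- Node `v` is occupied by a particle. -/
def Occupied (C : Config n) (v : Node) : Prop := ∃ i, C.pos i = v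

/-- All particles are contracted. -/
def AllContracted (C : Config n) : Prop := ∀ i, C.state i = .contracted

/-- The occupied nodes induce a connected subgraph of the grid. -/
def Connected (C : Config n) : Prop := (triGrid.induce (Set.range C.pos)).Connected

/-- Initial configurations: all particles contracted, and connected. -/
def IsInitial (C : Config n) : Prop := C.AllContracted ∧ C.Connected

/-- The (nodes of the) bounding box: the smallest parallelogram with sides parallel to the
West--East and SouthWest--NorthEast directions that contains all particles. For the product order on
`ℤ × ℤ`, the parallelograms with these sides are the intervals `Set.Icc lo hi`. -/
def boundingBox (C : Config n) : Set Node :=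
  ⋂₀ {B | (∃ lo hi : Node, B = Set.Icc lo hi) ∧ ∀ i, C.pos i ∈ B}

/-- The floor: the West--East line of the grid that contains the southern side of the bounding
box. -/
def floor (C : Config n) : Set Node :=
  {v | ∃ w ∈ C.boundingBox, (∀ u ∈ C.boundingBox, w.2 ≤ u.2) ∧ v.2 = w.2}

/-! ### The algorithm WRain

The nodes at distance one or two from `v` are numbered row by row from North to South, and from West
to East in each row: `1, 2, 3` / `4, 5, 6, 7` / `8, 9, v, 10, 11` / `12, 13, 14, 15` /
`16, 17, 18`. So `5, 6` are the neighbours of `v` to the NW and NE, `9, 10` those to the W and E,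
and `13, 14` those to the SW and SE. -/

/-- Some node at the positions `1, 2, 4, 5, 6` as seen from `v` is occupied. -/
def Upper (C : Config n) (v : Node) : Prop :=
  C.Occupied (v + Dir.NW.vec + Dir.NW.vec) ∨ C.Occupied (v + Dir.NW.vec + Dir.NE.vec) ∨
  C.Occupied (v + Dir.NW.vec + Dir.W.vec) ∨ C.Occupied (v + Dir.NW.vec) ∨
  C.Occupied (v + Dir.NE.vec)

/-- Some node at the positions `13, 14, 15, 17, 18` as seen from `v` is occupied. -/
def Lower (C : Config n) (v : Node) : Prop :=
  C.Occupied (v + Dir.SW.vec) ∨ C.Occupied (v + Dir.SE.vec) ∨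
  C.Occupied (v + Dir.SE.vec + Dir.E.vec) ∨ C.Occupied (v + Dir.SE.vec + Dir.SW.vec) ∨
  C.Occupied (v + Dir.SE.vec + Dir.SE.vec)

/-- Some particle on a neighbour of `v` is expanded toward `v`. -/
def Pointed (C : Config n) (v : Node) : Prop :=
  ∃ i d, C.state i = .expanded d ∧ C.pos i + d.vec = v

/-- Some neighbour of `v` is empty and pointed, that is, semi-occupied. -/
def Near (C : Config n) (v : Node) : Prop :=
  ∃ u, triGrid.Adj v u ∧ ¬ C.Occupied u ∧ C.Pointed u

open Classical in
/-- Algorithm WRain: the decision of a contracted particle on node `v` in the observed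
configuration `C`; `some d` means to expand in direction `d`, and `none` means to do nothing. -/
noncomputable def wrain (C : Config n) (v : Node) : Option Dir :=
  if C.Near v then none
  else if C.Pointed v then some .E
  else if ¬ C.Upper v ∧ C.Lower v then some .SE
  else none

end Config

/-! ### Asynchronous dynamics -/

/-- What an activated particle may decide to do. -/
inductive Action : Type
  | stay
  | expand (d : Dir)
  | contract

/-- The phase of a particle in its activity cycle: either inactive, or it has sensed its
surroundings and computed an action that it has not executed yet. -/
inductive Phase : Type
  | inactive
  | ready (a : Action)

/-- State of the whole system: the configuration and the phases of the particles. -/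
structure SysState (n : ℕ) where
  conf : Config n
  phase : Fin n → Phase

section Dynamics

variable {n : ℕ}

open Classical in
/-- The action that particle `i` decides when it observes configuration `C`: a contracted particle
follows the algorithm, an expanded one moves to the node it points to if it sees that node empty. -/
noncomputable def decision (alg : Config n → Node → Option Dir) (C : Config n) (i : Fin n) :
    Action :=
  match C.state i with
  | .contracted =>
    match alg C (C.pos i) with
    | none => .stay
    | some d => .expand d
  | .expanded d => if C.Occupied (C.pos i + d.vec) then .stay else .contract

/-- What particles may compete for: a node to move to, or an edge to expand along. -/
inductive Resource : Type
  | node (v : Node)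
  | edge (e : Sym2 Node)

/-- A node is free if no particle occupies it; an edge is free if no expanded particle occupies
it. -/
def Free (C : Config n) : Resource → Prop
  | .node v => ¬ C.Occupied v
  | .edge e => ∀ i d, C.state i = .expanded d → s(C.pos i, C.pos i + d.vec) ≠ e

/-- Particle `i` needs the resource `r` in order to execute the action that it has decided. -/
def Requests (S : SysState n) (i : Fin n) (r : Resource) : Prop :=
  (∃ d, S.phase i = .ready (.expand d) ∧
    r = .edge s(S.conf.pos i, S.conf.pos i + d.vec)) ∨
  (∃ d, S.phase i = .ready .contract ∧ S.conf.state i = .expanded d ∧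
    r = .node (S.conf.pos i + d.vec))

/-- `win` is a possible choice, by the adversary, of the particles whose expansion or contraction
succeeds when the particles of `act` are activated simultaneously: each free resource requested by
active particles is obtained by exactly one of them, and occupied resources are not obtained. -/
structure Resolves (S : SysState n) (act win : Set (Fin n)) : Prop where
  sound : ∀ i ∈ win, i ∈ act ∧ ∃ r, Requests S i r ∧ Free S.conf r
  unique : ∀ r, Free S.conf r → (∃ i ∈ act, Requests S i r) → ∃! i, i ∈ win ∧ Requests S i r

/-- Particle `i` has the same node and the same state in `C` and `C'`. -/
def Same (C C' : Config n) (i : Fin n) : Prop :=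
  C'.pos i = C.pos i ∧ C'.state i = C.state i

/-- One step of the system. Each particle of `act` performs the next phase of its cycle: an inactive
one senses the current configuration and computes an action, a ready one executes (or fails to
execute) the action computed before. The other particles do nothing. -/
structure Step (alg : Config n → Node → Option Dir) (act win : Set (Fin n))
    (S S' : SysState n) : Prop where
  resolves : Resolves S act win
  sleep : ∀ i, i ∉ act → Same S.conf S'.conf i ∧ S'.phase i = S.phase i
  look : ∀ i ∈ act, S.phase i = .inactive →
    Same S.conf S'.conf i ∧ S'.phase i = .ready (decision alg S.conf i)
  execute : ∀ i ∈ act, ∀ a, S.phase i = .ready a → S'.phase i = .inactive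
  fail : ∀ i ∈ act, i ∉ win → ∀ a, S.phase i = .ready a → Same S.conf S'.conf i
  expand : ∀ i ∈ win, ∀ d, S.phase i = .ready (.expand d) →
    S'.conf.pos i = S.conf.pos i ∧ S'.conf.state i = .expanded d
  contract : ∀ i ∈ win, ∀ d, S.phase i = .ready .contract → S.conf.state i = .expanded d →
    S'.conf.pos i = S.conf.pos i + d.vec ∧ S'.conf.state i = .contracted

/-- `S` is an execution of `alg` from the configuration `C₀` under the asynchronous scheduler that
activates the set `act t` at time `t`: all particles are inactive at the beginning, every step
follows the rules with some resolution of the conflicts, and the scheduler is fair, that is, every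
particle is activated infinitely often. -/
structure IsExecution (alg : Config n → Node → Option Dir) (C₀ : Config n)
    (act : ℕ → Set (Fin n)) (S : ℕ → SysState n) : Prop where
  start : (S 0).conf = C₀ ∧ ∀ i, (S 0).phase i = .inactive
  step : ∀ t, ∃ win, Step alg (act t) win (S t) (S (t + 1))
  fair : ∀ i t, ∃ t' ≥ t, i ∈ act t'

end Dynamics

end SILBOT

namespace SILBOT

open Filter Relation

variable {n : ℕ}

/-! ### Single steps -/

/-! WRain expands only East or South-East. `Regular` keeps the reason for each expansion valid under
delays: an East mover is pushed by a pointer that cannot advance while its target is occupied, and a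
South-East mover is above the lowest initial row `m`. So rows never increase, first coordinates
never decrease, and no particle passes below the floor.

Connectivity is carried by `SysState.Linked`, on occupied or pointed nodes. A South-East decision
may be outdated when executed, so links from above into a committed particle are not counted;
committing loses nothing because `Upper` and `Near` exclude them. When that particle departs, a link
of length two can replace the one to its western neighbour (`Regular.link_step`,
`Regular.linked_step`).

The configuration freezes (`exists_conf_eq`): rows stabilise, then the claimed set grows within size
`2n`, then first coordinates stabilise, finally states. By fairness every decision is then to stay
(`decision_eq_stay`). No particle is expanded: ahead of one with largest first coordinate there
would be a particle obliged to expand. No link descends from the top row, so there is a single row,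
where links are grid edges; an initially lowest particle keeps it at `m`. -/

/-- What can happen to a single particle during a step. -/
theorem Step.particle {alg : Config n → Node → Option Dir} {act win : Set (Fin n)}
    {S S' : SysState n} (h : Step alg act win S S') (i : Fin n) :
    (Same S.conf S'.conf i ∧ (S'.phase i = S.phase i ∨ S'.phase i = .inactive ∨
      (S.phase i = .inactive ∧ S'.phase i = .ready (decision alg S.conf i)))) ∨
    (∃ d, S.phase i = .ready (.expand d) ∧ S'.phase i = .inactive ∧
      S'.conf.pos i = S.conf.pos i ∧ S'.conf.state i = .expanded d) ∨
    (∃ d, S.conf.state i = .expanded d ∧ S'.phase i = .inactive ∧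
      S'.conf.pos i = S.conf.pos i + d.vec ∧ S'.conf.state i = .contracted ∧
      ¬ S.conf.Occupied (S.conf.pos i + d.vec)) := by
  by_cases hi : i ∈ act
  · by_cases hw : i ∈ win
    · obtain ⟨-, r, hr, hfree⟩ := h.resolves.sound i hw
      rcases hr with ⟨d, hp, rfl⟩ | ⟨d, hp, hs, rfl⟩
      · exact .inr (.inl ⟨d, hp, h.execute i hi _ hp, h.expand i hw d hp⟩)
      · have := h.contract i hw d hp hs
        exact .inr (.inr ⟨d, hs, h.execute i hi _ hp, this.1, this.2, hfree⟩)
    · cases hp : S.phase i with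
      | inactive =>
        have := h.look i hi hp
        exact .inl ⟨this.1, .inr (.inr ⟨rfl, this.2⟩)⟩
      | ready a => exact .inl ⟨h.fail i hi hw a hp, .inr (.inl (h.execute i hi a hp))⟩
  · have := h.sleep i hi
    exact .inl ⟨this.1, .inl this.2⟩

theorem decision_expand {alg : Config n → Node → Option Dir} {C : Config n} {i : Fin n} {d : Dir}
    (h : decision alg C i = .expand d) :
    C.state i = .contracted ∧ alg C (C.pos i) = some d := by
  unfold decision at h
  split at h
  · rename_i hs
    split at h
    · cases h
    · rename_i d' hd
      cases h
      exact ⟨hs, hd⟩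
  · split at h <;> cases h

namespace Config

theorem wrain_eq_some {C : Config n} {v : Node} {d : Dir} (h : C.wrain v = some d) :
    ¬ C.Near v ∧ ((d = .E ∧ C.Pointed v) ∨ (d = .SE ∧ ¬ C.Upper v ∧ C.Lower v)) := by
  unfold wrain at h
  split_ifs at h with h1 h2 h3
  · cases h; exact ⟨h1, .inl ⟨rfl, h2⟩⟩
  · cases h; exact ⟨h1, .inr ⟨rfl, h3⟩⟩

theorem Lower.row_lt {C : Config n} {v : Node} {m : ℤ} (hm : ∀ i, m ≤ (C.pos i).2)
    (h : C.Lower v) : m < v.2 := by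
  rcases h with ⟨i, hi⟩ | ⟨i, hi⟩ | ⟨i, hi⟩ | ⟨i, hi⟩ | ⟨i, hi⟩ <;>
  · have h1 := hm i
    rw [hi] at h1
    simp [Dir.vec] at h1
    omega

/-- The nodes that are occupied or that some particle is expanded toward. -/
def claimed (C : Config n) : Set Node := {v | C.Occupied v ∨ C.Pointed v}

theorem pos_mem_claimed (C : Config n) (i : Fin n) : C.pos i ∈ C.claimed := .inl ⟨i, rfl⟩

end Config

/-! ### Invariant on the directions of expansion -/

/-- In all expansions, either the direction is East and some particle pushes from behind, or the
direction is South-East and the particle is above row `m`, below which there is no particle. -/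
structure Regular (m : ℤ) (S : SysState n) : Prop where
  row_le : ∀ i, m ≤ (S.conf.pos i).2
  expanded : ∀ i d, S.conf.state i = .expanded d →
    (d = .E ∧ S.conf.Pointed (S.conf.pos i)) ∨ (d = .SE ∧ m < (S.conf.pos i).2)
  ready : ∀ i d, S.phase i = .ready (.expand d) → S.conf.state i = .contracted ∧
    ((d = .E ∧ S.conf.Pointed (S.conf.pos i)) ∨ (d = .SE ∧ m < (S.conf.pos i).2))

section Step

variable {act win : Set (Fin n)} {S S' : SysState n} {m : ℤ}

/-- A pointer toward an occupied node stays. -/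
theorem Regular.pointed_of_occupied (hR : Regular m S) (h : Step Config.wrain act win S S')
    {v : Node} (hv : S.conf.Occupied v) (hp : S.conf.Pointed v) : S'.conf.Pointed v := by
  obtain ⟨j, d, hj, rfl⟩ := hp
  refine ⟨j, d, ?_⟩
  rcases h.particle j with ⟨⟨h1, h2⟩, -⟩ | ⟨d', h1, -⟩ | ⟨d', h1, -, -, -, h2⟩
  · exact ⟨h2.trans hj, by rw [h1]⟩
  · have := (hR.ready j d' h1).1
    rw [hj] at this
    cases this
  · rw [hj] at h1
    cases h1
    exact absurd hv h2

/-- Outdated decisions stay justified: the pointer behind an East mover waits while its target is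
occupied, and the South-East condition depends only on the particle's own row. -/
theorem Regular.step (hR : Regular m S) (h : Step Config.wrain act win S S') :
    Regular m S' := by
  have key : ∀ i d, S'.conf.pos i = S.conf.pos i →
      ((d = Dir.E ∧ S.conf.Pointed (S.conf.pos i)) ∨ (d = .SE ∧ m < (S.conf.pos i).2)) →
      ((d = .E ∧ S'.conf.Pointed (S'.conf.pos i)) ∨ (d = .SE ∧ m < (S'.conf.pos i).2)) := by
    rintro i d hi (⟨h1, h2⟩ | h1)
    · exact .inl ⟨h1, by rw [hi]; exact hR.pointed_of_occupied h ⟨i, rfl⟩ h2⟩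
    · exact .inr (by rwa [hi])
  refine ⟨fun i => ?_, fun i d hd => ?_, fun i d hd => ?_⟩
  · rcases h.particle i with ⟨⟨h1, -⟩, -⟩ | ⟨d', -, -, h1, -⟩ | ⟨d', h1, -, h2, -⟩
    · rw [h1]; exact hR.row_le i
    · rw [h1]; exact hR.row_le i
    · have := hR.row_le i
      rw [h2]
      rcases hR.expanded i d' h1 with ⟨rfl, -⟩ | ⟨rfl, h3⟩ <;> simp [Dir.vec] <;> omega
  · rcases h.particle i with ⟨⟨h1, h2⟩, -⟩ | ⟨d', h1, -, h2, h3⟩ | ⟨d', h1, -, -, h2, -⟩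
    · exact key i d h1 (hR.expanded i d (h2 ▸ hd))
    · rw [hd] at h3
      cases h3
      exact key i d h2 (hR.ready i d h1).2
    · rw [hd] at h2
      cases h2
  · rcases h.particle i with ⟨⟨h1, h2⟩, h3 | h3 | ⟨-, h3⟩⟩ | ⟨d', -, h1, -⟩ | ⟨d', -, h1, -⟩
    · rw [h3] at hd
      exact ⟨h2.trans (hR.ready i d hd).1, key i d h1 (hR.ready i d hd).2⟩
    · rw [h3] at hd; cases hd
    · rw [h3] at hd
      have hd := decision_expand (Phase.ready.inj hd)
      refine ⟨h2.trans hd.1, key i d h1 ?_⟩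
      rcases (Config.wrain_eq_some hd.2).2 with h4 | ⟨h4, -, h5⟩
      · exact .inl h4
      · exact .inr ⟨h4, h5.row_lt hR.row_le⟩
    · rw [h1] at hd; cases hd
    · rw [h1] at hd; cases hd

/-! ### Connectivity -/

/-- The particle on node `v` has decided to move South-East, or is already expanded there. -/
def SysState.Committed (S : SysState n) (v : Node) : Prop :=
  ∃ i, S.conf.pos i = v ∧
    (S.phase i = .ready (.expand .SE) ∨ S.conf.state i = .expanded .SE)

/-- The links that keep the claimed nodes together. They include some pairs at distance two, and a
committed particle does not rely on the links to the nodes above it. -/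
inductive SysState.Link (S : SysState n) (a : Node) : Node → Prop
  | E (ha : a ∈ S.conf.claimed) (hb : a + Dir.E.vec ∈ S.conf.claimed)
      (h : ¬ S.Committed (a + Dir.E.vec) ∨ S.conf.Occupied a) : S.Link a (a + Dir.E.vec)
  | SW (ha : a ∈ S.conf.claimed) (hb : a + Dir.SW.vec ∈ S.conf.claimed)
      (h : ¬ S.Committed (a + Dir.SW.vec)) : S.Link a (a + Dir.SW.vec)
  | SE (ha : a ∈ S.conf.claimed) (hb : a + Dir.SE.vec ∈ S.conf.claimed)
      (h : ¬ S.Committed (a + Dir.SE.vec)) : S.Link a (a + Dir.SE.vec)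
  | SEE (ha : S.conf.Occupied a) (hb : a + Dir.SE.vec + Dir.E.vec ∈ S.conf.claimed)
      (h : ¬ S.Committed (a + Dir.SE.vec + Dir.E.vec)) :
      S.Link a (a + Dir.SE.vec + Dir.E.vec)

/-- Any two claimed nodes are joined by a chain of links. -/
def SysState.Linked (S : SysState n) : Prop :=
  ∀ a ∈ S.conf.claimed, ∀ b ∈ S.conf.claimed, EqvGen S.Link a b

theorem SysState.Committed.occupied {v : Node} (h : S.Committed v) : S.conf.Occupied v :=
  let ⟨i, hi, _⟩ := h; ⟨i, hi⟩

theorem SysState.Link.left_mem {a b : Node} (h : S.Link a b) : a ∈ S.conf.claimed := by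
  cases h
  · assumption
  · assumption
  · assumption
  · exact .inl ‹_›

theorem SysState.Link.right_mem {a b : Node} (h : S.Link a b) : b ∈ S.conf.claimed := by
  cases h <;> assumption

/-- The fate of an occupied node: it stays occupied, or its particle moves South-East, or it moves
East and leaves a node that another particle points to. -/
theorem Regular.occupied_step (hR : Regular m S) (h : Step Config.wrain act win S S') {a : Node}
    (ha : S.conf.Occupied a) :
    S'.conf.Occupied a ∨
    (S.Committed a ∧ S'.conf.Occupied (a + Dir.SE.vec) ∧ ¬ S'.Committed (a + Dir.SE.vec)) ∨
    (a ∈ S'.conf.claimed ∧ S'.conf.Occupied (a + Dir.E.vec) ∧ ¬ S'.Committed (a + Dir.E.vec) ∧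
      ¬ S.conf.Occupied (a + Dir.E.vec)) := by
  obtain ⟨i, rfl⟩ := ha
  rcases h.particle i with ⟨⟨h1, -⟩, -⟩ | ⟨d, -, -, h1, -⟩ | ⟨d, h1, h2, h3, h4, h5⟩
  · exact .inl ⟨i, h1⟩
  · exact .inl ⟨i, h1⟩
  -- A particle that has just moved is contracted and inactive, so links from above into its new
  -- node count.
  · have hc : ¬ S'.Committed (S.conf.pos i + d.vec) := by
      rintro ⟨j, hj, hj'⟩
      obtain rfl := S'.conf.inj (hj.trans h3.symm)
      rw [h2, h4] at hj'
      simp at hj'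
    rcases hR.expanded i d h1 with ⟨rfl, hp⟩ | ⟨rfl, -⟩
    · exact .inr (.inr ⟨.inr (hR.pointed_of_occupied h ⟨i, rfl⟩ hp), ⟨i, h3⟩, hc, h5⟩)
    · exact .inr (.inl ⟨⟨i, rfl, .inr h1⟩, ⟨i, h3⟩, hc⟩)

/-- A claimed node stays claimed, or its particle moves South-East. -/
theorem Regular.claimed_step (hR : Regular m S) (h : Step Config.wrain act win S S') {a : Node}
    (ha : a ∈ S.conf.claimed) :
    a ∈ S'.conf.claimed ∨
    (S.Committed a ∧ S'.conf.Occupied (a + Dir.SE.vec) ∧ ¬ S'.Committed (a + Dir.SE.vec)) := by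
  rcases ha with ha | ⟨i, d, hd, rfl⟩
  · rcases hR.occupied_step h ha with h1 | h1 | h1
    · exact .inl (.inl h1)
    · exact .inr h1
    · exact .inl h1.1
  · left
    rcases h.particle i with ⟨⟨h1, h2⟩, -⟩ | ⟨d', h1, -⟩ | ⟨d', h1, -, h2, -⟩
    · exact .inr ⟨i, d, h2.trans hd, by rw [h1]⟩
    · have := (hR.ready i d' h1).1
      rw [hd] at this
      cases this
    · rw [hd] at h1
      cases h1
      exact .inl ⟨i, h2⟩

/-- A particle that becomes committed loses no links. -/
theorem Step.committed (h : Step Config.wrain act win S S') {b : Node}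
    (hb : S'.Committed b) :
    S.Committed b ∨ (S.conf.Occupied b ∧ b + Dir.NW.vec ∉ S.conf.claimed ∧
      b + Dir.NE.vec ∉ S.conf.claimed ∧ ¬ S.conf.Occupied (b + Dir.NW.vec + Dir.W.vec) ∧
      (b + Dir.W.vec ∈ S.conf.claimed → S.conf.Occupied (b + Dir.W.vec))) := by
  obtain ⟨i, rfl, hi⟩ := hb
  rcases h.particle i with ⟨⟨h1, h2⟩, h3⟩ | ⟨d, h1, h2, h3, h4⟩ | ⟨d, -, h1, -, h2, -⟩
  · rw [h1]
    rw [h2] at hi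
    rcases hi with hi | hi
    · rcases h3 with h3 | h3 | ⟨-, h3⟩
      · exact .inl ⟨i, rfl, .inl (h3 ▸ hi)⟩
      · rw [h3] at hi; cases hi
      · rw [h3] at hi
        obtain ⟨hn, ⟨h4, -⟩ | ⟨-, hu, -⟩⟩ :=
          Config.wrain_eq_some (decision_expand (Phase.ready.inj hi)).2
        · cases h4
        -- A claimed but empty neighbour would be semi-occupied, against `¬ Near`.
        · have key : ∀ d : Dir, S.conf.pos i + d.vec ∈ S.conf.claimed →
              S.conf.Occupied (S.conf.pos i + d.vec) := fun d hd => by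
            by_contra ho
            exact hn ⟨_, ⟨d, rfl⟩, ho, hd.resolve_left ho⟩
          simp only [Config.Upper, not_or] at hu
          exact .inr ⟨⟨i, rfl⟩, fun h => hu.2.2.2.1 (key _ h), fun h => hu.2.2.2.2 (key _ h),
            hu.2.2.1, key _⟩
    · exact .inl ⟨i, rfl, .inr hi⟩
  · rw [h2, h4] at hi
    rw [h3]
    rcases hi with hi | hi
    · cases hi
    · cases hi
      exact .inl ⟨i, rfl, .inl h1⟩
  · rw [h1, h2] at hi
    simp at hi

end Step

/-! ### Transport of links through a step -/

section Step

variable {act win : Set (Fin n)} {S S' : SysState n} {m : ℤ}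

/-- Follow a claimed node along the move that makes it unclaimed, if there is one. -/
theorem Regular.exists_follow (hR : Regular m S) (h : Step Config.wrain act win S S') {a : Node}
    (ha : a ∈ S.conf.claimed) :
    ∃ b ∈ S'.conf.claimed, (a ∈ S'.conf.claimed ∧ b = a) ∨
      (a ∉ S'.conf.claimed ∧ b = a + Dir.SE.vec ∧ S.Committed a ∧ S'.conf.Occupied b ∧
        ¬ S'.Committed b) := by
  by_cases h1 : a ∈ S'.conf.claimed
  · exact ⟨a, h1, .inl ⟨h1, rfl⟩⟩
  · have := (hR.claimed_step h ha).resolve_left h1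
    exact ⟨_, .inl this.2.1, .inr ⟨h1, rfl, this⟩⟩

namespace SysState

variable {a b : Node}

theorem eqvGen_E (ha : a ∈ S.conf.claimed) (hb : b ∈ S.conf.claimed)
    (h : ¬ S.Committed b ∨ S.conf.Occupied a) (e : b = a + Dir.E.vec) : EqvGen S.Link a b := by
  subst e; exact .rel _ _ (.E ha hb h)

theorem eqvGen_SW (ha : a ∈ S.conf.claimed) (hb : b ∈ S.conf.claimed)
    (h : ¬ S.Committed b) (e : b = a + Dir.SW.vec) : EqvGen S.Link a b := by
  subst e; exact .rel _ _ (.SW ha hb h)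

theorem eqvGen_SE (ha : a ∈ S.conf.claimed) (hb : b ∈ S.conf.claimed)
    (h : ¬ S.Committed b) (e : b = a + Dir.SE.vec) : EqvGen S.Link a b := by
  subst e; exact .rel _ _ (.SE ha hb h)

theorem eqvGen_SEE (ha : S.conf.Occupied a) (hb : b ∈ S.conf.claimed)
    (h : ¬ S.Committed b) (e : b = a + Dir.SE.vec + Dir.E.vec) : EqvGen S.Link a b := by
  subst e; exact .rel _ _ (.SEE ha hb h)

end SysState

open SysState

/-- The end points of a link, followed through a step, are still joined by links. -/
theorem Regular.link_step (hR : Regular m S) (h : Step Config.wrain act win S S')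
    {f : Node → Node}
    (hf : ∀ a ∈ S.conf.claimed, f a ∈ S'.conf.claimed ∧ ((a ∈ S'.conf.claimed ∧ f a = a) ∨
      (a ∉ S'.conf.claimed ∧ f a = a + Dir.SE.vec ∧ S.Committed a ∧ S'.conf.Occupied (f a) ∧
        ¬ S'.Committed (f a))))
    {a b : Node} (hab : S.Link a b) : EqvGen S'.Link (f a) (f b) := by
  have ha := hab.left_mem
  have hb := hab.right_mem
  have stay : ∀ b ∈ S.conf.claimed, ¬ S.Committed b → b ∈ S'.conf.claimed ∧ f b = b := by
    intro b hb hc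
    rcases (hf b hb).2 with h1 | ⟨-, -, h1, -⟩
    · exact h1
    · exact absurd h1 hc
  rcases hab with ⟨-, -, hl⟩ | ⟨-, -, hl⟩ | ⟨-, -, hl⟩ | ⟨ho, -, hl⟩
  · obtain ⟨hfb, hb'⟩ := hf _ hb
    obtain ⟨hfa, ⟨ha', e⟩ | ⟨ha', e, hca, hao, hac⟩⟩ := hf a ha
    · rcases hb' with ⟨hb', e'⟩ | ⟨hb', e', hcb, hbo, hbc⟩
      · rw [e, e']
        by_cases hc : S'.Committed (a + Dir.E.vec)
        · have hbo : S.conf.Occupied (a + Dir.E.vec) := by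
            rcases h.committed hc with h1 | h1
            · exact h1.occupied
            · exact h1.1
          -- If the eastern end has only just committed, it saw its claimed western neighbour `a` as
          -- not semi-occupied.
          have hao : S.conf.Occupied a := by
            rcases h.committed hc with h1 | ⟨-, -, -, -, h1⟩
            · exact hl.resolve_left (not_not.2 h1)
            · have e : a + Dir.E.vec + Dir.W.vec = a := by ext <;> simp [Dir.vec]
              rw [e] at h1
              exact h1 ha
          rcases hR.occupied_step h hao with h1 | ⟨-, h1, h2⟩ | ⟨-, -, -, h1⟩
          · exact eqvGen_E ha' hb' (.inr h1) rfl
          -- The particle on `a` left South-East while `a` stays pointed: detour through its new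
          -- node.
          · exact (eqvGen_SE ha' (.inl h1) h2 rfl).trans _ _ _
              (eqvGen_SW hb' (.inl h1) h2 (by ext <;> simp [Dir.vec])).symm
          · exact absurd hbo h1
        · exact eqvGen_E ha' hb' (.inl hc) rfl
      -- Only the eastern end departs. The proviso in `Link.E` makes `a` occupied, as the replacing
      -- link `SEE` requires.
      · have hao := hl.resolve_left (not_not.2 hcb)
        rw [e]
        rcases hR.occupied_step h hao with h1 | ⟨-, h1, h2⟩ | ⟨-, -, -, h1⟩
        · exact eqvGen_SEE h1 hfb hbc (by rw [e', add_right_comm])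
        · exact (eqvGen_SE ha' (.inl h1) h2 rfl).trans _ _ _
            (eqvGen_E (.inl h1) hfb (.inl hbc) (by rw [e', add_right_comm]))
        · exact absurd hcb.occupied h1
    · rcases hb' with ⟨hb', e'⟩ | ⟨hb', e', hcb, hbo, hbc⟩
      · exact (eqvGen_SW hfb hfa hac (by rw [e, e']; ext <;> simp [Dir.vec])).symm
      · exact eqvGen_E hfa hfb (.inl hbc) (by rw [e, e', add_right_comm])
  · obtain ⟨hb', e'⟩ := stay _ hb hl
    have hc : ¬ S'.Committed (a + Dir.SW.vec) := by
      intro hc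
      have := ((h.committed hc).resolve_left hl).2.2.1
      have e : a + Dir.SW.vec + Dir.NE.vec = a := by ext <;> simp [Dir.vec]
      rw [e] at this
      exact this ha
    rw [e']
    obtain ⟨hfa, ⟨ha', e⟩ | ⟨ha', e, hca, hao, hac⟩⟩ := hf a ha
    · rw [e]
      exact eqvGen_SW ha' hb' hc rfl
    · exact (eqvGen_E hb' hfa (.inl hac) (by rw [e]; ext <;> simp [Dir.vec])).symm
  · obtain ⟨hb', e'⟩ := stay _ hb hl
    have hc : ¬ S'.Committed (a + Dir.SE.vec) := by
      intro hc
      have := ((h.committed hc).resolve_left hl).2.1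
      have e : a + Dir.SE.vec + Dir.NW.vec = a := by ext <;> simp [Dir.vec]
      rw [e] at this
      exact this ha
    rw [e']
    obtain ⟨hfa, ⟨ha', e⟩ | ⟨ha', e, hca, hao, hac⟩⟩ := hf a ha
    · rw [e]
      exact eqvGen_SE ha' hb' hc rfl
    -- The upper end has moved onto the lower one.
    · rw [e]
      exact .refl _
  · obtain ⟨hb', e'⟩ := stay _ hb hl
    -- Seen from the lower end, `a` is position 4 of `Upper`; an occupied `a` prevents a new
    -- commitment.
    have hc : ¬ S'.Committed (a + Dir.SE.vec + Dir.E.vec) := by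
      intro hc
      have := ((h.committed hc).resolve_left hl).2.2.2.1
      have e : a + Dir.SE.vec + Dir.E.vec + Dir.NW.vec + Dir.W.vec = a := by
        ext <;> simp [Dir.vec]
      rw [e] at this
      exact this ho
    rw [e']
    obtain ⟨hfa, ⟨ha', e⟩ | ⟨ha', e, hca, hao, hac⟩⟩ := hf a ha
    · rw [e]
      rcases hR.occupied_step h ho with h1 | ⟨-, h1, h2⟩ | ⟨-, h1, h2, -⟩
      · exact eqvGen_SEE h1 hb' hc rfl
      · exact (eqvGen_SE ha' (.inl h1) h2 rfl).trans _ _ _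
          (eqvGen_E (.inl h1) hb' (.inl hc) rfl)
      · exact (eqvGen_E ha' (.inl h1) (.inl h2) rfl).trans _ _ _
          (eqvGen_SE (.inl h1) hb' hc (add_right_comm _ _ _))
    · exact eqvGen_E hfa hb' (.inl hc) (by rw [e])

/-- Links keep the claimed nodes together through a step. -/
theorem Regular.linked_step (hR : Regular m S) (hL : S.Linked)
    (h : Step Config.wrain act win S S') : S'.Linked := by
  choose! f hf using fun a ha => hR.exists_follow h (a := a) ha
  have hf' : ∀ a ∈ S.conf.claimed, f a ∈ S'.conf.claimed ∧ ((a ∈ S'.conf.claimed ∧ f a = a) ∨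
      (a ∉ S'.conf.claimed ∧ f a = a + Dir.SE.vec ∧ S.Committed a ∧ S'.conf.Occupied (f a) ∧
        ¬ S'.Committed (f a))) := hf
  have hmap : ∀ a b, EqvGen S.Link a b → EqvGen S'.Link (f a) (f b) := by
    intro a b hab
    induction hab with
    | rel a b hab => exact hR.link_step h hf' hab
    | refl a => exact .refl _
    | symm a b _ ih => exact ih.symm
    | trans a b c _ _ ih₁ ih₂ => exact ih₁.trans _ _ _ ih₂
  have old : ∀ c ∈ S.conf.claimed, c ∈ S'.conf.claimed → f c = c := by
    intro c hc hc'
    rcases (hf' c hc).2 with h1 | h1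
    · exact h1.2
    · exact absurd hc' h1.1
  -- A new claimed node comes from an expansion. It was not occupied before, hence is not committed
  -- now, and is linked to the expanding particle.
  have hnew : ∀ c ∈ S'.conf.claimed, ∃ a ∈ S.conf.claimed, EqvGen S'.Link c (f a) := by
    intro c hc
    by_cases hcS : c ∈ S.conf.claimed
    · refine ⟨c, hcS, ?_⟩
      rw [old c hcS hc]
      exact .refl _
    · have hnc : ¬ S'.Committed c := fun hcom => by
        rcases h.committed hcom with h1 | h1
        · exact hcS (.inl h1.occupied)
        · exact hcS (.inl h1.1)
      rcases hc with ⟨i, rfl⟩ | ⟨i, d, hd, rfl⟩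
      · exfalso
        rcases h.particle i with ⟨⟨h1, -⟩, -⟩ | ⟨d, -, -, h1, -⟩ | ⟨d, h1, -, h2, -⟩
        · exact hcS (h1 ▸ S.conf.pos_mem_claimed i)
        · exact hcS (h1 ▸ S.conf.pos_mem_claimed i)
        · exact hcS (.inr ⟨i, d, h1, h2.symm⟩)
      · have hpos : S'.conf.pos i = S.conf.pos i := by
          rcases h.particle i with ⟨⟨h1, -⟩, -⟩ | ⟨d, -, -, h1, -⟩ | ⟨d, -, -, -, h1, -⟩
          · exact h1
          · exact h1
          · rw [hd] at h1; cases h1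
        have hmem := S'.conf.pos_mem_claimed i
        refine ⟨_, S.conf.pos_mem_claimed i, ?_⟩
        rw [old _ (S.conf.pos_mem_claimed i) (hpos ▸ hmem), ← hpos]
        rcases (hR.step h).expanded i d hd with ⟨rfl, -⟩ | ⟨rfl, -⟩
        · exact (eqvGen_E hmem (.inr ⟨i, _, hd, rfl⟩) (.inl hnc) rfl).symm
        · exact (eqvGen_SE hmem (.inr ⟨i, _, hd, rfl⟩) hnc rfl).symm
  intro a ha b hb
  obtain ⟨a', ha', h1⟩ := hnew a ha
  obtain ⟨b', hb', h2⟩ := hnew b hb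
  exact (h1.trans _ _ _ (hmap _ _ (hL a' ha' b' hb'))).trans _ _ _ h2.symm

end Step

/-! ### The beginning of an execution -/

-- Nothing is committed yet, so the provisos of links hold, and `E`, `SW`, `SE` with their reverses
-- give all six directions.
open SysState in
theorem linked_of_connected {S : SysState n} (hC : S.conf.IsInitial)
    (hp : ∀ i, S.phase i = .inactive) : S.Linked := by
  obtain ⟨hc, hconn⟩ := hC
  have hcom : ∀ v, ¬ S.Committed v := by
    rintro v ⟨i, -, h | h⟩
    · rw [hp i] at h; cases h
    · rw [hc i] at h; cases h
  have hmem : ∀ v ∈ S.conf.claimed, v ∈ Set.range S.conf.pos := by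
    rintro v (hv | ⟨i, d, hd, -⟩)
    · exact hv
    · rw [hc i] at hd; cases hd
  have key : ∀ a b : Set.range S.conf.pos, triGrid.Adj a b → EqvGen S.Link a b := by
    rintro ⟨a, ha⟩ ⟨b, hb⟩ ⟨d, hd⟩
    dsimp only at hd ⊢
    have ha : a ∈ S.conf.claimed := .inl ha
    have hb : b ∈ S.conf.claimed := .inl hb
    cases d
    · exact eqvGen_E ha hb (.inl (hcom _)) hd
    · exact (eqvGen_SW hb ha (hcom _) (by rw [hd]; ext <;> simp [Dir.vec])).symm
    · exact (eqvGen_SE hb ha (hcom _) (by rw [hd]; ext <;> simp [Dir.vec])).symm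
    · exact (eqvGen_E hb ha (.inl (hcom _)) (by rw [hd]; ext <;> simp [Dir.vec])).symm
    · exact eqvGen_SW ha hb (hcom _) hd
    · exact eqvGen_SE ha hb (hcom _) hd
  intro a ha b hb
  obtain ⟨w⟩ := hconn.preconnected ⟨a, hmem a ha⟩ ⟨b, hmem b hb⟩
  suffices ∀ a b : Set.range S.conf.pos, (triGrid.induce (Set.range S.conf.pos)).Walk a b →
      EqvGen S.Link a b from this _ _ w
  intro a b w
  induction w with
  | nil => exact .refl _
  | cons hab _ ih => exact (key _ _ hab).trans _ _ _ ih

theorem regular_of_initial {S : SysState n} {m : ℤ} (hc : S.conf.AllContracted)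
    (hp : ∀ i, S.phase i = .inactive) (hm : ∀ i, m ≤ (S.conf.pos i).2) : Regular m S := by
  refine ⟨hm, fun i d h => ?_, fun i d h => ?_⟩
  · rw [hc i] at h; cases h
  · rw [hp i] at h; cases h

theorem Config.mem_floor {C : Config n} {m : ℤ} (hm : ∀ i, m ≤ (C.pos i).2) {i₀ : Fin n}
    (hi₀ : (C.pos i₀).2 = m) {v : Node} (hv : v.2 = m) : v ∈ C.floor := by
  refine ⟨C.pos i₀, ?_, fun u hu => ?_, hv.trans hi₀.symm⟩
  · rintro B ⟨-, hB⟩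
    exact hB i₀
  · obtain ⟨lo, hlo⟩ := (Set.finite_range fun i => (C.pos i).1).bddBelow
    obtain ⟨hi, hhi⟩ := (Set.finite_range C.pos).bddAbove
    -- A parallelogram around all particles with southern side on row `m` bounds the box from below.
    have := hu (Set.Icc (lo, m) hi) ⟨⟨_, _, rfl⟩, fun i =>
      ⟨⟨hlo ⟨i, rfl⟩, hm i⟩, hhi ⟨i, rfl⟩⟩⟩
    rw [hi₀]
    exact this.1.2

/-! ### Termination -/

theorem eventually_eq_of_le {f : ℕ → ℕ} (h : ∀ᶠ t in atTop, f (t + 1) ≤ f t) :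
    ∀ᶠ t in atTop, f (t + 1) = f t := by
  obtain ⟨T, hT⟩ := eventually_atTop.1 h
  have hanti : Antitone fun k => f (T + k) :=
    antitone_nat_of_succ_le fun k => hT (T + k) (Nat.le_add_right T k)
  obtain ⟨N, hN⟩ := WellFoundedLT.antitone_chain_condition hanti
  refine eventually_atTop.2 ⟨T + N, fun t ht => ?_⟩
  obtain ⟨k, rfl⟩ := Nat.exists_eq_add_of_le ht
  have h1 := hN (N + k) (by omega)
  have h2 := hN (N + k + 1) (by omega)
  simp only [← add_assoc] at h1 h2
  exact h2.symm.trans h1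

theorem exists_forall_eq {α : Type*} {f : ℕ → α} (h : ∀ᶠ t in atTop, f (t + 1) = f t) :
    ∃ T, ∀ t, T ≤ t → f t = f T := by
  obtain ⟨T, hT⟩ := eventually_atTop.1 h
  refine ⟨T, fun t ht => ?_⟩
  induction t, ht using Nat.le_induction with
  | base => rfl
  | succ t ht ih => exact (hT t ht).trans ih

namespace Config

theorem eq_of_pos_state {C C' : Config n} (hp : ∀ i, C.pos i = C'.pos i)
    (hs : ∀ i, C.state i = C'.state i) : C = C' := by
  cases C
  cases C'
  obtain rfl := funext hp
  obtain rfl := funext hs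
  rfl

/-- The node that particle `i` occupies when it is contracted, or points to otherwise. -/
def head (C : Config n) (i : Fin n) : Node :=
  match C.state i with
  | .contracted => C.pos i
  | .expanded d => C.pos i + d.vec

theorem claimed_subset (C : Config n) : C.claimed ⊆ Set.range C.pos ∪ Set.range C.head := by
  rintro v (hv | ⟨i, d, hd, rfl⟩)
  · exact .inl hv
  · exact .inr ⟨i, by simp [head, hd]⟩

theorem finite_claimed (C : Config n) : C.claimed.Finite :=
  ((Set.finite_range _).union (Set.finite_range _)).subset C.claimed_subset

theorem ncard_claimed_le (C : Config n) : C.claimed.ncard ≤ n + n := by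
  have key : ∀ f : Fin n → Node, (Set.range f).ncard ≤ n := fun f => by
    rw [← Set.image_univ]
    refine (Set.ncard_image_le Set.finite_univ).trans ?_
    simp [Set.ncard_univ]
  calc C.claimed.ncard ≤ (Set.range C.pos ∪ Set.range C.head).ncard :=
        Set.ncard_le_ncard C.claimed_subset ((Set.finite_range _).union (Set.finite_range _))
    _ ≤ _ := (Set.ncard_union_le _ _).trans (add_le_add (key _) (key _))

end Config

/-! ### Monotone quantities -/

section Step

variable {act win : Set (Fin n)} {S S' : SysState n} {m : ℤ}

theorem Regular.pos_step (hR : Regular m S) (h : Step Config.wrain act win S S') (i : Fin n) :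
    S'.conf.pos i = S.conf.pos i ∨ ∃ d, S.conf.state i = .expanded d ∧
      S'.conf.pos i = S.conf.pos i + d.vec ∧
      ((d = .E ∧ S.conf.Pointed (S.conf.pos i)) ∨ d = .SE) := by
  rcases h.particle i with ⟨⟨h1, -⟩, -⟩ | ⟨d, -, -, h1, -⟩ | ⟨d, h1, -, h2, -⟩
  · exact .inl h1
  · exact .inl h1
  · exact .inr ⟨d, h1, h2, (hR.expanded i d h1).imp_right And.left⟩

theorem Regular.row_step (hR : Regular m S) (h : Step Config.wrain act win S S') (i : Fin n) :
    (S'.conf.pos i).2 ≤ (S.conf.pos i).2 := by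
  rcases hR.pos_step h i with h1 | ⟨d, -, h1, ⟨rfl, -⟩ | rfl⟩ <;> simp [h1, Dir.vec]

theorem Regular.column_step (hR : Regular m S) (h : Step Config.wrain act win S S')
    (i : Fin n) :
    (S.conf.pos i).1 ≤ (S'.conf.pos i).1 ∧
      ((S'.conf.pos i).1 = (S.conf.pos i).1 → S'.conf.pos i = S.conf.pos i) := by
  rcases hR.pos_step h i with h1 | ⟨d, -, h1, ⟨rfl, -⟩ | rfl⟩ <;> simp [h1, Dir.vec]

/-- Only a South-East move can make a node unclaimed, and it would lower a row. -/
theorem Regular.claimed_mono (hR : Regular m S) (h : Step Config.wrain act win S S')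
    (hrow : ∀ i, (S'.conf.pos i).2 = (S.conf.pos i).2) : S.conf.claimed ⊆ S'.conf.claimed := by
  intro a ha
  rcases hR.claimed_step h ha with h1 | ⟨⟨i, rfl, -⟩, -⟩
  · exact h1
  · rcases hR.pos_step h i with h1 | ⟨d, -, h1, ⟨rfl, hp⟩ | rfl⟩
    · exact .inl ⟨i, h1⟩
    · exact .inr (hR.pointed_of_occupied h ⟨i, rfl⟩ hp)
    · have := hrow i
      simp [h1, Dir.vec] at this

/-- Expanded particles cannot expand again, and they contract only by moving. -/
theorem Regular.state_step (hR : Regular m S) (h : Step Config.wrain act win S S') {i : Fin n}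
    (hpos : S'.conf.pos i = S.conf.pos i) (hs : S.conf.state i ≠ .contracted) :
    S'.conf.state i = S.conf.state i := by
  rcases h.particle i with ⟨⟨-, h1⟩, -⟩ | ⟨d, h1, -⟩ | ⟨d, -, -, h1, -⟩
  · exact h1
  · exact absurd (hR.ready i d h1).1 hs
  · rw [hpos] at h1
    cases d <;> simp [Prod.ext_iff, Dir.vec] at h1

end Step

section Execution

variable {act : ℕ → Set (Fin n)} {S : ℕ → SysState n} {m : ℤ}

theorem eventually_row_eq (hR : ∀ t, Regular m (S t))
    (hS : ∀ t, ∃ win, Step Config.wrain (act t) win (S t) (S (t + 1))) :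
    ∀ᶠ t in atTop, ∀ i, ((S (t + 1)).conf.pos i).2 = ((S t).conf.pos i).2 := by
  rw [eventually_all]
  intro i
  have := eventually_eq_of_le (f := fun t => (((S t).conf.pos i).2 - m).toNat)
    (Eventually.of_forall fun t => by
      obtain ⟨win, h⟩ := hS t
      have := (hR t).row_step h i
      omega)
  filter_upwards [this] with t ht
  have h1 := (hR t).row_le i
  have h2 := (hR (t + 1)).row_le i
  omega

theorem exists_claimed_eq (hR : ∀ t, Regular m (S t))
    (hS : ∀ t, ∃ win, Step Config.wrain (act t) win (S t) (S (t + 1))) :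
    ∃ T, ∀ t, T ≤ t → (S t).conf.claimed = (S T).conf.claimed := by
  have hmono : ∀ᶠ t in atTop, (S t).conf.claimed ⊆ (S (t + 1)).conf.claimed := by
    filter_upwards [eventually_row_eq hR hS] with t ht
    obtain ⟨win, h⟩ := hS t
    exact (hR t).claimed_mono h ht
  -- Each particle claims at most its own node and its `head`, so the subtraction does not truncate.
  have := eventually_eq_of_le (f := fun t => n + n - (S t).conf.claimed.ncard) (by
    filter_upwards [hmono] with t ht
    have := Set.ncard_le_ncard ht (Config.finite_claimed _)
    omega)
  refine exists_forall_eq ?_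
  filter_upwards [hmono, this] with t h1 h2
  have h3 := (S t).conf.ncard_claimed_le
  have h4 := (S (t + 1)).conf.ncard_claimed_le
  exact (Set.eq_of_subset_of_ncard_le h1 (by omega) (Config.finite_claimed _)).symm

theorem eventually_pos_eq (hR : ∀ t, Regular m (S t))
    (hS : ∀ t, ∃ win, Step Config.wrain (act t) win (S t) (S (t + 1))) :
    ∀ᶠ t in atTop, ∀ i, (S (t + 1)).conf.pos i = (S t).conf.pos i := by
  obtain ⟨T, hT⟩ := exists_claimed_eq hR hS
  -- Positions stay inside one fixed finite claimed set, which bounds eastward progress.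
  obtain ⟨B, hB⟩ := ((Config.finite_claimed (S T).conf).image Prod.fst).bddAbove
  have hle : ∀ t, T ≤ t → ∀ i, ((S t).conf.pos i).1 ≤ B := fun t ht i =>
    hB ⟨_, hT t ht ▸ (S t).conf.pos_mem_claimed i, rfl⟩
  rw [eventually_all]
  intro i
  have := eventually_eq_of_le (f := fun t => (B - ((S t).conf.pos i).1).toNat)
    (Eventually.of_forall fun t => by
      obtain ⟨win, h⟩ := hS t
      have := ((hR t).column_step h i).1
      omega)
  filter_upwards [this, eventually_ge_atTop T] with t ht hTt
  obtain ⟨win, h⟩ := hS t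
  have h1 := hle t hTt i
  have h2 := hle (t + 1) (by omega) i
  exact ((hR t).column_step h i).2 (by omega)

/-- The configuration changes only finitely often. -/
theorem exists_conf_eq (hR : ∀ t, Regular m (S t))
    (hS : ∀ t, ∃ win, Step Config.wrain (act t) win (S t) (S (t + 1))) :
    ∃ T, ∀ t, T ≤ t → (S t).conf = (S T).conf := by
  classical
  refine exists_forall_eq ?_
  have hstate : ∀ᶠ t in atTop, ∀ i, (S (t + 1)).conf.state i = (S t).conf.state i := by
    rw [eventually_all]
    intro i
    have hkeep : ∀ᶠ t in atTop, (S t).conf.state i ≠ .contracted →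
        (S (t + 1)).conf.state i = (S t).conf.state i := by
      filter_upwards [eventually_pos_eq hR hS] with t ht
      obtain ⟨win, h⟩ := hS t
      exact (hR t).state_step h (ht i)
    -- With positions fixed, an expanded particle stays expanded, so the indicator of being
    -- contracted cannot increase.
    have := eventually_eq_of_le
      (f := fun t => if (S t).conf.state i = .contracted then 1 else 0) (by
        filter_upwards [hkeep] with t ht
        by_cases h : (S t).conf.state i = .contracted
        · rw [if_pos h]
          split_ifs <;> omega
        · rw [ht h])
    filter_upwards [hkeep, this] with t h1 h2
    by_cases h : (S t).conf.state i = .contracted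
    · rw [if_pos h] at h2
      rw [h]
      by_contra h3
      simp [if_neg h3] at h2
    · exact h1 h
  filter_upwards [eventually_pos_eq hR hS, hstate] with t h1 h2
  exact Config.eq_of_pos_state h1 h2

/-! ### Fairness -/

/-- At the first activation from time `t` on, the phase is still the one at `t`. -/
theorem exists_next_activation {alg : Config n → Node → Option Dir}
    (hS : ∀ t, ∃ win, Step alg (act t) win (S t) (S (t + 1)))
    (hfair : ∀ i t, ∃ t' ≥ t, i ∈ act t') (i : Fin n) (t : ℕ) :
    ∃ t' ≥ t, i ∈ act t' ∧ (S t').phase i = (S t).phase i := by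
  obtain ⟨t', ht, hi⟩ := hfair i t
  obtain ⟨k, rfl⟩ := Nat.exists_eq_add_of_le ht
  clear ht
  induction k generalizing t with
  | zero => exact ⟨t, le_rfl, hi, rfl⟩
  | succ k ih =>
    by_cases h : i ∈ act t
    · exact ⟨t, le_rfl, h, rfl⟩
    · obtain ⟨t', h1, h2, h3⟩ := ih (t + 1) (by rwa [add_right_comm])
      obtain ⟨win, hw⟩ := hS t
      exact ⟨t', by omega, h2, h3.trans (hw.sleep i h).2⟩

theorem exists_look {alg : Config n → Node → Option Dir}
    (hS : ∀ t, ∃ win, Step alg (act t) win (S t) (S (t + 1)))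
    (hfair : ∀ i t, ∃ t' ≥ t, i ∈ act t') (i : Fin n) (t : ℕ) :
    ∃ t' ≥ t, i ∈ act t' ∧ (S t').phase i = .inactive := by
  obtain ⟨t₁, h1, h2, -⟩ := exists_next_activation hS hfair i t
  cases hp : (S t₁).phase i with
  | inactive => exact ⟨t₁, h1, h2, hp⟩
  | ready a =>
    obtain ⟨win, hw⟩ := hS t₁
    obtain ⟨t₂, h3, h4, h5⟩ := exists_next_activation hS hfair i (t₁ + 1)
    exact ⟨t₂, by omega, h4, h5.trans (hw.execute i h2 a hp)⟩

/-- A step that does not change the configuration has no successful particle. -/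
theorem Regular.not_mem_win {a win : Set (Fin n)} {S S' : SysState n} (hR : Regular m S)
    (h : Step Config.wrain a win S S') (he : S'.conf = S.conf) (j : Fin n) : j ∉ win := by
  intro hj
  obtain ⟨-, r, ⟨d, hp, -⟩ | ⟨d, hp, hs, -⟩, -⟩ := h.resolves.sound j hj
  · have h1 := (h.expand j hj d hp).2
    rw [he, (hR.ready j d hp).1] at h1
    cases h1
  · have h1 := (h.contract j hj d hp hs).2
    rw [he, hs] at h1
    cases h1

/-- When the configuration does not change any more, every particle decides to stay. -/
theorem decision_eq_stay (hR : ∀ t, Regular m (S t))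
    (hS : ∀ t, ∃ win, Step Config.wrain (act t) win (S t) (S (t + 1)))
    (hfair : ∀ i t, ∃ t' ≥ t, i ∈ act t') {T : ℕ}
    (hT : ∀ t, T ≤ t → (S t).conf = (S T).conf) (i : Fin n) :
    decision Config.wrain (S T).conf i = .stay := by
  obtain ⟨t₁, h1, h2, h3⟩ := exists_look hS hfair i T
  obtain ⟨win, hw⟩ := hS t₁
  obtain ⟨t, h4, h5, h6⟩ := exists_next_activation hS hfair i (t₁ + 1)
  rw [(hw.look i h2 h3).2, hT t₁ h1] at h6
  have hconf := hT t (by omega)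
  obtain ⟨win', hw'⟩ := hS t
  -- A free requested resource would have a winner, and every winner changes the configuration.
  have hno : ∀ r, Requests (S t) i r → ¬ Free (S t).conf r := by
    intro r hr hf
    obtain ⟨j, ⟨hj, -⟩, -⟩ := hw'.resolves.unique r hf ⟨i, h5, hr⟩
    exact (hR t).not_mem_win hw' ((hT (t + 1) (by omega)).trans hconf.symm) j hj
  cases hd : decision Config.wrain (S T).conf i with
  | stay => rfl
  | expand d =>
    rw [hd] at h6
    obtain ⟨hc, hd'⟩ := (hR t).ready i d h6
    refine absurd ?_ (hno _ (.inl ⟨d, h6, rfl⟩))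
    intro k d' hk he
    rcases Sym2.eq_iff.1 he with ⟨h7, -⟩ | ⟨h7, h8⟩
    · obtain rfl := (S t).conf.inj h7
      rw [hc] at hk
      cases hk
    -- Another particle occupying the edge from its other end would point oppositely, but both
    -- directions increase the first coordinate.
    · have h9 := congrArg Prod.fst h8
      rw [h7] at h9
      rcases hd' with ⟨rfl, -⟩ | ⟨rfl, -⟩ <;>
        rcases (hR t).expanded k d' hk with ⟨rfl, -⟩ | ⟨rfl, -⟩ <;> simp [Dir.vec] at h9 <;> omega
  | contract =>
    rw [hd] at h6
    unfold decision at hd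
    split at hd
    · split at hd <;> cases hd
    · rename_i d hs
      split at hd
      · cases hd
      · rename_i ho
        rw [← hconf] at hs ho
        exact absurd ho (hno _ (.inr ⟨d, h6, hs, rfl⟩))

end Execution

/-! ### Quiescent configurations -/

theorem decision_expanded_eq_stay {alg : Config n → Node → Option Dir} {C : Config n} {i : Fin n}
    {d : Dir} (hs : C.state i = .expanded d) (h : decision alg C i = .stay) :
    C.Occupied (C.pos i + d.vec) := by
  by_contra ho
  simp [decision, hs, ho] at h

theorem decision_contracted_eq_stay {alg : Config n → Node → Option Dir} {C : Config n}
    {i : Fin n} (hs : C.state i = .contracted) (h : decision alg C i = .stay) :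
    alg C (C.pos i) = none := by
  cases hd : alg C (C.pos i) with
  | none => rfl
  | some d => simp [decision, hs, hd] at h

/-- Take an expanded particle with largest first coordinate. Its occupied target lies further along,
so it holds a contracted particle; that one is pointed at and must expand East. -/
theorem Regular.allContracted {S : SysState n} {m : ℤ} (hR : Regular m S)
    (h : ∀ i, decision Config.wrain S.conf i = .stay) : S.conf.AllContracted := by
  by_contra hc
  simp only [Config.AllContracted, not_forall] at hc
  obtain ⟨i, hi, hmax⟩ := Set.exists_max_image {i | S.conf.state i ≠ .contracted}
    (fun i => (S.conf.pos i).1) (Set.toFinite _) hc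
  cases hs : S.conf.state i with
  | contracted => exact hi hs
  | expanded d =>
    obtain ⟨j, hj⟩ := decision_expanded_eq_stay hs (h i)
    have hjc : S.conf.state j = .contracted := by
      by_contra hjc
      have h1 := hmax j hjc
      rw [hj] at h1
      rcases hR.expanded i d hs with ⟨rfl, -⟩ | ⟨rfl, -⟩ <;> simp [Dir.vec] at h1
    have hw := decision_contracted_eq_stay hjc (h j)
    have hp : S.conf.Pointed (S.conf.pos j) := ⟨i, d, hs, hj.symm⟩
    -- All targets of expanded particles are occupied, so no node is semi-occupied.
    have hn : ¬ S.conf.Near (S.conf.pos j) := by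
      rintro ⟨u, -, hu, k, d', hk, rfl⟩
      exact hu (decision_expanded_eq_stay hk (h k))
    simp [Config.wrain, hn, hp] at hw

theorem Config.not_lower_of_stay {C : Config n} (hc : C.AllContracted)
    (h : ∀ i, decision Config.wrain C i = .stay) {v : Node} (hv : C.Occupied v)
    (hu : ¬ C.Upper v) : ¬ C.Lower v := by
  obtain ⟨i, rfl⟩ := hv
  have hw := decision_contracted_eq_stay (hc i) (h i)
  have hp : ∀ u, ¬ C.Pointed u := by
    rintro u ⟨j, d, hj, -⟩
    rw [hc j] at hj
    cases hj
  have hn : ¬ C.Near (C.pos i) := fun ⟨u, _, _, h⟩ => hp u h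
  intro hl
  simp [Config.wrain, hn, hp, hu, hl] at hw

theorem claimed_eq_range {C : Config n} (hc : C.AllContracted) :
    C.claimed = Set.range C.pos := by
  ext v
  refine ⟨?_, fun hv => .inl hv⟩
  rintro (hv | ⟨j, d, hj, -⟩)
  · exact hv
  · rw [hc j] at hj
    cases hj

/-- A quiescent configuration whose claimed nodes are linked occupies a single row. -/
theorem SysState.Linked.row_eq {S : SysState n} (hL : S.Linked) (hc : S.conf.AllContracted)
    (h : ∀ i, decision Config.wrain S.conf i = .stay) (i j : Fin n) :
    (S.conf.pos i).2 = (S.conf.pos j).2 := by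
  obtain ⟨k, -, hmax⟩ := Set.exists_max_image Set.univ (fun i => (S.conf.pos i).2)
    Set.finite_univ ⟨i, trivial⟩
  suffices ∀ a b, EqvGen S.Link a b → (a.2 = (S.conf.pos k).2 ↔ b.2 = (S.conf.pos k).2) by
    have key : ∀ i, (S.conf.pos i).2 = (S.conf.pos k).2 := fun i =>
      (this _ _ (hL _ (S.conf.pos_mem_claimed k) _ (S.conf.pos_mem_claimed i))).1 rfl
    rw [key i, key j]
  have hle : ∀ v, S.conf.Occupied v → v.2 ≤ (S.conf.pos k).2 := by
    rintro v ⟨i, rfl⟩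
    exact hmax i trivial
  -- In the top row `Upper` fails, hence so does `Lower`, whose positions 13, 14, 15 are the lower
  -- ends of `SW`, `SE`, `SEE`.
  have hnl : ∀ a, S.conf.Occupied a → S.conf.Lower a → a.2 ≠ (S.conf.pos k).2 := by
    intro a ha hl he
    refine Config.not_lower_of_stay hc h ha ?_ hl
    rintro (h1 | h1 | h1 | h1 | h1) <;>
    · have := hle _ h1
      simp [Dir.vec] at this
      omega
  intro a b hab
  induction hab with
  | rel a b hab =>
    have ha := hab.left_mem
    have hb := hab.right_mem
    rw [claimed_eq_range hc] at ha hb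
    have ha' := hle a ha
    have hb' := hle b hb
    cases hab with
    | E => simp [Dir.vec]
    | SW =>
      have := hnl a ha (.inl hb)
      simp [Dir.vec] at *
      omega
    | SE =>
      have := hnl a ha (.inr (.inl hb))
      simp [Dir.vec] at *
      omega
    | SEE =>
      have := hnl a ha (.inr (.inr (.inl hb)))
      simp [Dir.vec] at *
      omega
  | refl a => exact Iff.rfl
  | symm a b _ ih => exact ih.symm
  | trans a b c _ _ ih₁ ih₂ => exact ih₁.trans ih₂

theorem SysState.Linked.connected {S : SysState n} (hL : S.Linked) (hc : S.conf.AllContracted)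
    (hrow : ∀ i j, (S.conf.pos i).2 = (S.conf.pos j).2) (i₀ : Fin n) : S.conf.Connected := by
  -- The alternative `a = b` covers reflexivity at unoccupied nodes.
  suffices ∀ a b, EqvGen S.Link a b → a = b ∨ ∃ (ha : a ∈ Set.range S.conf.pos)
      (hb : b ∈ Set.range S.conf.pos),
      (triGrid.induce (Set.range S.conf.pos)).Reachable ⟨a, ha⟩ ⟨b, hb⟩ by
    refine { preconnected := ?_, nonempty := ⟨⟨_, i₀, rfl⟩⟩ }
    rintro ⟨_, i, rfl⟩ ⟨_, j, rfl⟩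
    rcases this _ _ (hL _ (S.conf.pos_mem_claimed i) _ (S.conf.pos_mem_claimed j)) with
      h | ⟨_, _, h⟩
    · obtain rfl := S.conf.inj h
      exact .refl _
    · exact h
  intro a b hab
  induction hab with
  | rel a b hab =>
    have ha := hab.left_mem
    have hb := hab.right_mem
    rw [claimed_eq_range hc] at ha hb
    have he : a.2 = b.2 := by
      obtain ⟨i, rfl⟩ := ha
      obtain ⟨j, rfl⟩ := hb
      exact hrow i j
    refine .inr ⟨ha, hb, SimpleGraph.Adj.reachable ?_⟩
    cases hab with
    | E => exact ⟨.E, rfl⟩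
    | SW => simp [Dir.vec] at he
    | SE => simp [Dir.vec] at he
    | SEE => simp [Dir.vec] at he
  | refl a => exact .inl rfl
  | symm a b _ ih =>
    rcases ih with rfl | ⟨ha, hb, h⟩
    · exact .inl rfl
    · exact .inr ⟨hb, ha, h.symm⟩
  | trans a b c _ _ ih₁ ih₂ =>
    rcases ih₁ with rfl | ⟨ha, hb, h⟩
    · exact ih₂
    · rcases ih₂ with rfl | ⟨hb', hc, h'⟩
      · exact .inr ⟨ha, hb, h⟩
      · exact .inr ⟨ha, hc, h.trans h'⟩

/-- A particle on row `m` stays there. -/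
theorem Regular.row_eq_step {act win : Set (Fin n)} {S S' : SysState n} {m : ℤ}
    (hR : Regular m S) (h : Step Config.wrain act win S S') {i : Fin n}
    (hi : (S.conf.pos i).2 = m) : (S'.conf.pos i).2 = m :=
  le_antisymm (hi ▸ hR.row_step h i) ((hR.step h).row_le i)

end SILBOT

/-! ### Combination of the invariants with quiescence -/

/-- In every fair asynchronous execution of WRain from a connected configuration of `n` contracted
particles, a time `T` exists from which on the configuration does not change any more, and then all
particles are contracted, connected and on the floor of the starting configuration. -/
theorem theorem2 (n : ℕ) (C₀ : SILBOT.Config n) (hC₀ : C₀.IsInitial)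
    (act : ℕ → Set (Fin n)) (S : ℕ → SILBOT.SysState n)
    (hS : SILBOT.IsExecution SILBOT.Config.wrain C₀ act S) :
    ∃ T : ℕ, (∀ t, T ≤ t → (S t).conf = (S T).conf) ∧
      (S T).conf.AllContracted ∧ (S T).conf.Connected ∧
      ∀ i, (S T).conf.pos i ∈ C₀.floor := by
  obtain ⟨⟨hstart, hphase⟩, hstep, hfair⟩ := hS
  obtain ⟨⟨_, i₁, -⟩⟩ := hC₀.2.nonempty
  obtain ⟨i₀, -, hmin⟩ := Set.exists_min_image Set.univ (fun i => (C₀.pos i).2)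
    Set.finite_univ ⟨i₁, trivial⟩
  have hmin : ∀ i, (C₀.pos i₀).2 ≤ (C₀.pos i).2 := fun i => hmin i trivial
  subst hstart
  -- The particle `i₀`, lowest at the start, never leaves its row and so identifies the final row
  -- with the floor.
  have hinv : ∀ t, SILBOT.Regular ((S 0).conf.pos i₀).2 (S t) ∧ (S t).Linked ∧
      ((S t).conf.pos i₀).2 = ((S 0).conf.pos i₀).2 := by
    intro t
    induction t with
    | zero =>
      exact ⟨SILBOT.regular_of_initial hC₀.1 hphase hmin,
        SILBOT.linked_of_connected hC₀ hphase, rfl⟩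
    | succ t ih =>
      obtain ⟨win, h⟩ := hstep t
      exact ⟨ih.1.step h, ih.1.linked_step ih.2.1 h, ih.1.row_eq_step h ih.2.2⟩
  obtain ⟨T, hT⟩ := SILBOT.exists_conf_eq (fun t => (hinv t).1) hstep
  have hstay := SILBOT.decision_eq_stay (fun t => (hinv t).1) hstep hfair hT
  have hc := (hinv T).1.allContracted hstay
  have hrow := (hinv T).2.1.row_eq hc hstay
  exact ⟨T, hT, hc, (hinv T).2.1.connected hc hrow i₀, fun i =>
    SILBOT.Config.mem_floor hmin rfl ((hrow i i₀).trans (hinv T).2.2)⟩
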